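/- Let $P$ be a poset, and let $P_0$ be the poset obtained from $P$ by adjoining a new bottom element $0$, with order relation $\le_0$. Assume that $P_0$ is locally finite, i.e. all its intervals are finite, and let $\mu_0$ be its Möbius function. Let $P^*$ be the set of all finite words $w = w(1)w(2)\cdots w(n)$, $n \ge 0$, with letters in $P$; write $|w| = n$ for the length. Order $P^*$ by generalized subword order: $u \le w$ if and only if there are indices $i_1 < i_2 < \cdots < i_k$ with $k = |u|$ such that $u(j) \le w(i_j)$ in $P$ for $1 \le j \le k$. Then $P^*$ is a locally finite poset; let $\mu$ be its Möbius function. For $u, w \in P^*$, an embedding of $u$ in $w$ is a word $\eta = \eta(1)\cdots\eta(|w|)$ over $P_0$ of length $|w|$ such that deleting all letters $0$ from $\eta$ leaves exactly $u$, and such that $\eta(j) \le_0 w(j)$ for all $j$. If $u \le w$ in $P^*$, then $$ \mu(u,w) = \sum_{\eta} \ \prod_{1 \le j \le |w|} \begin{cases} \mu_0(\eta(j), w(j)) + 1 & \text{if } \eta(j) = 0 \text{ and } w(j-1) = w(j),\\ \mu_0(\eta(j), w(j)) & \text{otherwise}, \end{cases} $$ where the sum is over all embeddings $\eta$ of $u$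 in $w$, and for $j = 1$ the condition $w(j-1) = w(j)$ is considered false. -/

import Mathlib

/-- The set `P*` of all finite words over the alphabet `P`. It is a structure, not a synonym of
`List P`, so that it does not inherit the lexicographic order of lists. -/
@[ext]
structure PosetWord (P : Type*) where
  /-- The letters of the word, from left to right. -/
  letters : List P

namespace PosetWord

instance {P : Type*} [DecidableEq P] : DecidableEq (PosetWord P) := fun u w =>
  decidable_of_iff (u.letters = w.letters) PosetWord.ext_iff.symm

/-- The length `|w|` of a word. -/
def length {P : Type*} (w : PosetWord P) : ℕ := w.letters.length

/-- The letter of `w` at position `j`; positions are counted from `0`. -/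
def letter {P : Type*} (w : PosetWord P) (j : Fin w.length) : P := w.letters.get j

/-- Generalized subword order: `u ≤ w` if and only if some (not necessarily consecutive) subword
`v` of `w` has the same length as `u` and satisfies `u(j) ≤ v(j)` for every `j`. -/
instance {P : Type*} [PartialOrder P] : LE (PosetWord P) where
  le u w := ∃ v : List P, v.Sublist w.letters ∧ List.Forall₂ (· ≤ ·) u.letters v

theorem le_iff_sublistForall₂ {P : Type*} [PartialOrder P] {u w : PosetWord P} :
    u ≤ w ↔ List.SublistForall₂ (· ≤ ·) u.letters w.letters := by
  rw [List.sublistForall₂_iff]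
  exact exists_congr fun _ => and_comm

theorem length_le {P : Type*} [PartialOrder P] {u w : PosetWord P} (h : u ≤ w) :
    u.length ≤ w.length := by
  obtain ⟨v, hv, huv⟩ := h
  exact huv.length_eq.trans_le hv.length_le

theorem forall₂_of_le {P : Type*} [PartialOrder P] {u w : PosetWord P} (h : u ≤ w)
    (hlen : w.length ≤ u.length) : List.Forall₂ (· ≤ ·) u.letters w.letters := by
  obtain ⟨v, hv, huv⟩ := h
  have hl : w.letters.length ≤ v.length := hlen.trans_eq huv.length_eq
  exact hv.eq_of_length_le hl ▸ huv

instance {P : Type*} [PartialOrder P] : PartialOrder (PosetWord P) where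
  le_refl u := ⟨u.letters, List.Sublist.refl _, List.forall₂_refl _⟩
  le_trans a b c hab hbc := by
    rw [le_iff_sublistForall₂] at *
    exact _root_.trans hab hbc
  le_antisymm u w huw hwu := by
    have h₁ := forall₂_of_le huw (length_le hwu)
    have h₂ := forall₂_of_le hwu (length_le huw)
    rw [List.forall₂_iff_get] at h₁ h₂
    ext1
    exact List.ext_get h₁.1 fun i hi hi' => le_antisymm (h₁.2 i hi hi') (h₂.2 i hi' hi)

/-- If the poset `P_0` is locally finite, there are finitely many words below a given word. -/
theorem finite_sublistForall₂ {P : Type*} [PartialOrder P] [LocallyFiniteOrder (WithBot P)]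
    (l : List P) : {k : List P | List.SublistForall₂ (· ≤ ·) k l}.Finite := by
  induction l with
  | nil =>
    refine (Set.finite_singleton ([] : List P)).subset fun k hk => ?_
    cases hk
    rfl
  | cons b l ih =>
    have hb : {a : P | a ≤ b}.Finite := by
      refine Set.Finite.of_finite_image (f := ((↑) : P → WithBot P)) ?_
        (WithBot.coe_injective.injOn)
      refine (Set.finite_Icc (⊥ : WithBot P) (b : WithBot P)).subset ?_
      rintro _ ⟨a, ha, rfl⟩
      exact ⟨bot_le, WithBot.coe_le_coe.2 ha⟩
    refine (ih.union (Set.Finite.image2 List.cons hb ih)).subset fun k hk => ?_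
    cases hk with
    | nil => exact Or.inl List.SublistForall₂.nil
    | cons h₁ h₂ => exact Or.inr ⟨_, h₁, _, h₂, rfl⟩
    | cons_right h => exact Or.inl h

theorem finite_Icc {P : Type*} [PartialOrder P] [LocallyFiniteOrder (WithBot P)]
    (u w : PosetWord P) : (Set.Icc u w).Finite := by
  refine Set.Finite.of_finite_image (f := PosetWord.letters) ?_
    (fun a _ b _ h => PosetWord.ext h)
  refine (finite_sublistForall₂ w.letters).subset ?_
  rintro _ ⟨x, hx, rfl⟩
  exact le_iff_sublistForall₂.1 hx.2

/-- `P*` is locally finite when `P_0` is, so that it has a Möbius function. -/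
noncomputable instance {P : Type*} [PartialOrder P] [LocallyFiniteOrder (WithBot P)] :
    LocallyFiniteOrder (PosetWord P) :=
  LocallyFiniteOrder.ofFiniteIcc finite_Icc

/-- A word `η` over `P_0 = WithBot P` is an expansion of `u` if deleting the letters `0 = ⊥` from
`η` leaves exactly `u`. -/
def IsExpansion {P : Type*} [DecidableEq P] (η : List (WithBot P)) (u : PosetWord P) : Prop :=
  η.filter (· ≠ ⊥) = u.letters.map (↑)

/-- An embedding of `u` in `w`: an expansion `η = η(0) η(1) ⋯` of `u`, of length `|w|`,
with `η(j) ≤ w(j)` in `P_0` for all `j`. -/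
def IsEmbedding {P : Type*} [PartialOrder P] [DecidableEq P] (u w : PosetWord P)
    (η : Fin w.length → WithBot P) : Prop :=
  IsExpansion (List.ofFn η) u ∧ ∀ j, η j ≤ (w.letter j : WithBot P)

theorem finite_isEmbedding {P : Type*} [PartialOrder P] [DecidableEq P]
    [LocallyFiniteOrder (WithBot P)] (u w : PosetWord P) :
    {η : Fin w.length → WithBot P | IsEmbedding u w η}.Finite := by
  refine (Set.Finite.pi' fun j =>
    Set.finite_Icc (⊥ : WithBot P) (w.letter j : WithBot P)).subset fun η hη j => ?_
  exact ⟨bot_le, hη.2 j⟩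

/-- The finite set of all embeddings of `u` in `w`. -/
noncomputable def embeddings {P : Type*} [PartialOrder P] [DecidableEq P]
    [LocallyFiniteOrder (WithBot P)] (u w : PosetWord P) :
    Finset (Fin w.length → WithBot P) :=
  (finite_isEmbedding u w).toFinset

/-- The position `j` of `w` is preceded by a position carrying the same letter. This is false for
the first position. -/
def RepeatsPrevious {P : Type*} (w : PosetWord P) (j : Fin w.length) : Prop :=
  ∃ i : Fin w.length, (i : ℕ) + 1 = j ∧ w.letter i = w.letter j

end PosetWord

/-!
Write `F(u, w)` for the sum over embeddings on the right-hand side. Since `μ` is the inverse of `ζ`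
in the incidence algebra, it suffices to show `∑ v ∈ [u, w], F(v, w) = δ(u, w)`
(`sum_Icc_embeddingSum`).

Grouping embeddings by the word they embed, this sum runs over all words `η` over `P_0` which are
letterwise below `w` and whose nonzero letters form a word above `u`. Whether `u` lies below a word
is decided by greedy matching from left to right (`sublistForall₂_cons_cons_iff`), so the sum can be
evaluated one letter of `w` at a time. As the weight of a letter of `η` depends on the preceding
letter of `w`, the recursion is carried out for the sum `weightedSum c u l`, where `c` is the letter
preceding the word `l`, or `none`. Only two facts about `μ₀` enter: for letters `a`, `b` of `P`,
`∑ x ∈ [0, b], μ₀(x, b) = 0` and `∑ x ∈ [a, b], μ₀(x, b) = δ(a, b)`. They give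
`G(c, a u, b l) = δ(a, b) G(b, u, l) + ([c = b] - δ(a, b)) G(b, a u, l)` for `G = weightedSum`.
The solution of this recursion is the indicator of `l = u` when there is no preceding letter,
and of `l = p ⋯ p u`, with any number of letters `p` in front, when the preceding letter is `p`
(`weightedSum_none`, `weightedSum_some`).
-/

open IncidenceAlgebra

namespace PosetWord

variable {P : Type*}

/-! ### Deleting zeros and greedy matching -/

/-- The word over `P` obtained from a word over `P_0 = WithBot P` by deleting all letters `0`. -/
def eraseBot : List (WithBot P) → List P
  | [] => []
  | ⊥ :: l => eraseBot l
  | (a : P) :: l => a :: eraseBot l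

@[simp] theorem eraseBot_nil : eraseBot ([] : List (WithBot P)) = [] := rfl

@[simp] theorem eraseBot_bot_cons (l : List (WithBot P)) : eraseBot (⊥ :: l) = eraseBot l := rfl

@[simp] theorem eraseBot_coe_cons (a : P) (l : List (WithBot P)) :
    eraseBot ((a : WithBot P) :: l) = a :: eraseBot l := rfl

theorem filter_ne_bot_eq_map_eraseBot [DecidableEq P] (l : List (WithBot P)) :
    l.filter (· ≠ ⊥) = (eraseBot l).map (↑) := by
  induction l with
  | nil => rfl
  | cons x l ih => cases x <;> simp_all

theorem isExpansion_iff [DecidableEq P] {η : List (WithBot P)} {u : PosetWord P} :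
    IsExpansion η u ↔ (⟨eraseBot η⟩ : PosetWord P) = u := by
  rw [IsExpansion, filter_ne_bot_eq_map_eraseBot,
    (List.map_injective_iff.2 WithBot.coe_injective).eq_iff, PosetWord.ext_iff]

/-! ### Repeated letters -/

theorem repeatsPrevious_iff {w : PosetWord P} {j : Fin w.length} :
    w.RepeatsPrevious j ↔
      (none :: w.letters.map some).getD j none = some (w.letters.get j) := by
  obtain ⟨_ | j, hj⟩ := j
  · simp [RepeatsPrevious]
  · have hj' : j < w.letters.length := Nat.lt_of_succ_lt hj
    have h : (none :: w.letters.map some).getD (j + 1) none = some (w.letters.get ⟨j, hj'⟩) := by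
      simp [hj']
    rw [h, Option.some_inj]
    constructor
    · rintro ⟨⟨i, hi⟩, hij, h⟩
      obtain rfl : i = j := Nat.succ_injective hij
      exact h
    · exact fun h => ⟨⟨j, hj'⟩, rfl, h⟩

theorem exists_replicate_append_iff {p : P} {u l : List P} :
    (∃ k, l = List.replicate k p ++ u) ↔ l = u ∨ ∃ k, l = List.replicate k p ++ p :: u := by
  constructor
  · rintro ⟨_ | k, rfl⟩
    · exact Or.inl rfl
    · exact Or.inr ⟨k, by rw [List.replicate_succ', List.append_assoc]; rfl⟩
  · rintro (rfl | ⟨k, rfl⟩)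
    · exact ⟨0, rfl⟩
    · exact ⟨k + 1, by rw [List.replicate_succ', List.append_assoc]; rfl⟩

theorem ne_replicate_append_cons (p : P) (u : List P) (k : ℕ) :
    u ≠ List.replicate k p ++ p :: u := fun h => by
  have := congrArg List.length h
  simp at this
  omega

/-! ### Words over `P_0` letterwise below a word -/

section PartialOrder

variable [PartialOrder P]

/-- Greedy matching: if the first letter of `u` can be matched with the first letter of `m`, then
doing so loses nothing. -/
theorem sublistForall₂_cons_cons_iff {a d : P} {u m : List P} :
    List.SublistForall₂ (· ≤ ·) (a :: u) (d :: m) ↔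
      (a ≤ d ∧ List.SublistForall₂ (· ≤ ·) u m) ∨
        (¬ a ≤ d ∧ List.SublistForall₂ (· ≤ ·) (a :: u) m) := by
  constructor
  · intro h
    by_cases had : a ≤ d
    · refine Or.inl ⟨had, ?_⟩
      cases h with
      | cons _ h => exact h
      | cons_right h => exact _root_.trans (List.tail_sublistForall₂_self (a :: u)) h
    · refine Or.inr ⟨had, ?_⟩
      cases h with
      | cons h' _ => exact absurd h' had
      | cons_right h => exact h
  · rintro (⟨had, h⟩ | ⟨_, h⟩)
    · exact .cons had h
    · exact .cons_right h

theorem cons_sublistForall₂_eraseBot_cons_iff {a : P} {x : WithBot P} {u : List P}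
    {m : List (WithBot P)} :
    List.SublistForall₂ (· ≤ ·) (a :: u) (eraseBot (x :: m)) ↔
      ((a : WithBot P) ≤ x ∧ List.SublistForall₂ (· ≤ ·) u (eraseBot m)) ∨
        (¬ (a : WithBot P) ≤ x ∧ List.SublistForall₂ (· ≤ ·) (a :: u) (eraseBot m)) := by
  cases x with
  | bot => simp
  | coe d =>
    rw [eraseBot_coe_cons, sublistForall₂_cons_cons_iff, WithBot.coe_le_coe]

theorem sublistForall₂_eraseBot_ofFn {l : List P} {η : Fin l.length → WithBot P}
    (hη : ∀ j, η j ≤ (l.get j : WithBot P)) :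
    List.SublistForall₂ (· ≤ ·) (eraseBot (List.ofFn η)) l := by
  induction l with
  | nil => simpa using List.SublistForall₂.nil
  | cons b l ih =>
    have h0 : η 0 ≤ (b : WithBot P) := hη 0
    have ht := ih (η := fun j => η j.succ) fun j => hη j.succ
    have hcons : List.ofFn η = η 0 :: List.ofFn (fun j : Fin l.length => η j.succ) :=
      List.ofFn_succ
    rw [hcons]
    generalize η 0 = x at h0
    cases x with
    | bot => exact .cons_right ht
    | coe d => exact .cons (WithBot.coe_le_coe.1 h0) ht

variable [LocallyFiniteOrder (WithBot P)]

/-- The words over `P_0` letterwise below `l`. -/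
noncomputable def lowerWords (l : List P) : Finset (Fin l.length → WithBot P) :=
  Fintype.piFinset fun j => Finset.Icc ⊥ (l.get j : WithBot P)

theorem mem_lowerWords {l : List P} {η : Fin l.length → WithBot P} :
    η ∈ lowerWords l ↔ ∀ j, η j ≤ (l.get j : WithBot P) := by
  simp [lowerWords]

theorem sum_lowerWords_cons (b : P) (l : List P)
    (f : (Fin (l.length + 1) → WithBot P) → ℤ) :
    ∑ η ∈ lowerWords (b :: l), f η =
      ∑ x ∈ Finset.Icc ⊥ (b : WithBot P), ∑ η ∈ lowerWords l, f (Fin.cons x η) := by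
  rw [← Finset.sum_product']
  refine Finset.sum_bij' (fun η _ => (η 0, Fin.tail η))
    (fun p _ => (Fin.cons p.1 p.2 : Fin (l.length + 1) → WithBot P)) ?_ ?_ ?_ ?_ ?_
  · intro η hη
    rw [mem_lowerWords] at hη
    exact Finset.mem_product.2
      ⟨Finset.mem_Icc.2 ⟨bot_le, hη 0⟩, mem_lowerWords.2 fun j => hη j.succ⟩
  · intro p hp
    rw [Finset.mem_product, Finset.mem_Icc, mem_lowerWords] at hp
    exact mem_lowerWords.2 (Fin.cases hp.1.2 hp.2)
  · intro η _
    exact Fin.cons_self_tail (α := fun _ : Fin (l.length + 1) => WithBot P) η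
  · intro p _
    rfl
  · intro η _
    exact congrArg f (Fin.cons_self_tail (α := fun _ : Fin (l.length + 1) => WithBot P) η).symm

end PartialOrder

/-! ### Weights of embeddings -/

variable [PartialOrder P] [DecidableEq P] [LocallyFiniteOrder (WithBot P)]

/-- The weight of the letter `x` of an embedding at a position where the large word has the letter
`b`, preceded by the letter `c`, with `c = none` at the first position. -/
noncomputable def letterWeight (c : Option P) (b : P) (x : WithBot P) : ℤ :=
  if x = ⊥ ∧ c = some b then mu ℤ x (b : WithBot P) + 1 else mu ℤ x (b : WithBot P)

theorem sum_letterWeight (c : Option P) (b : P) :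
    ∑ x ∈ Finset.Icc ⊥ (b : WithBot P), letterWeight c b x = if c = some b then 1 else 0 := by
  have h (x : WithBot P) : letterWeight c b x =
      mu ℤ x (b : WithBot P) + if x = ⊥ then (if c = some b then 1 else 0) else 0 := by
    unfold letterWeight
    by_cases hx : x = ⊥ <;> by_cases hc : c = some b <;> simp [hx, hc]
  simp only [h, Finset.sum_add_distrib, sum_Icc_mu_left, Finset.sum_ite_eq']
  simp

/-- One step of greedy matching against the letter `a`: `A` and `B` are the values of the rest of
the sum when the current letter `x` does and does not match `a`. -/
theorem sum_letterWeight_mul_ite (c : Option P) (a b : P) (A B : ℤ)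
    [DecidablePred fun x : WithBot P => (a : WithBot P) ≤ x] :
    ∑ x ∈ Finset.Icc ⊥ (b : WithBot P), letterWeight c b x * (if (a : WithBot P) ≤ x then A else B) =
      (if a = b then A else 0) + ((if c = some b then 1 else 0) - (if a = b then 1 else 0)) * B := by
  have hfilter : (Finset.Icc ⊥ (b : WithBot P)).filter (fun x => (a : WithBot P) ≤ x) =
      Finset.Icc (a : WithBot P) b := by
    ext x
    simp [and_comm]
  have hup : ∑ x ∈ Finset.Icc (a : WithBot P) b, letterWeight c b x = if a = b then 1 else 0 := by
    rw [← if_congr (WithBot.coe_inj (a := a) (b := b)) rfl rfl, ← sum_Icc_mu_left]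
    refine Finset.sum_congr rfl fun x hx => if_neg fun h => ?_
    have := (Finset.mem_Icc.1 hx).1
    rw [h.1] at this
    exact WithBot.not_coe_le_bot a this
  have hsplit (x : WithBot P) : letterWeight c b x * (if (a : WithBot P) ≤ x then A else B) =
      letterWeight c b x * B + (if (a : WithBot P) ≤ x then letterWeight c b x else 0) * (A - B) := by
    split_ifs <;> ring
  simp only [hsplit, Finset.sum_add_distrib, ← Finset.sum_mul]
  rw [← Finset.sum_filter, hfilter, hup, sum_letterWeight]
  split_ifs <;> ring

/-- The weight of a word `η` over `P_0` letterwise below `l`, when `l` is preceded by the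
letter `c`. The letter preceding position `j` of `l` has index `j` in the list
`c :: l`, written with letters in `Option P` because `c` may be absent. -/
noncomputable def embeddingWeight (c : Option P) (l : List P) (η : Fin l.length → WithBot P) : ℤ :=
  ∏ j : Fin l.length, letterWeight ((c :: l.map some).getD j none) (l.get j) (η j)

theorem embeddingWeight_cons (c : Option P) (b : P) (l : List P) (x : WithBot P)
    (η : Fin l.length → WithBot P) :
    embeddingWeight c (b :: l) (Fin.cons x η : Fin (l.length + 1) → WithBot P) =
      letterWeight c b x * embeddingWeight (some b) l η :=
  Fin.prod_univ_succ (n := l.length) _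

/-! ### Evaluation of the weighted sum -/

open Classical in
/-- The total weight of the words `η` over `P_0` letterwise below `l` whose nonzero letters form a
word above `u`, when `l` is preceded by the letter `c`. -/
noncomputable def weightedSum (c : Option P) (u l : List P) : ℤ :=
  ∑ η ∈ lowerWords l,
    if List.SublistForall₂ (· ≤ ·) u (eraseBot (List.ofFn η)) then embeddingWeight c l η else 0

theorem weightedSum_nil_nil (c : Option P) : weightedSum c ([] : List P) [] = 1 := by
  simp [weightedSum, lowerWords, embeddingWeight, List.SublistForall₂.nil]

theorem weightedSum_cons_nil (c : Option P) (a : P) (u : List P) :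
    weightedSum c (a :: u) [] = 0 := by
  have h : ¬ List.SublistForall₂ (· ≤ ·) (a :: u) [] := fun h => by cases h
  simp [weightedSum, h]

theorem weightedSum_nil_cons (c : Option P) (b : P) (l : List P) :
    weightedSum c [] (b :: l) = (if c = some b then 1 else 0) * weightedSum (some b) [] l := by
  simp only [weightedSum, List.SublistForall₂.nil, if_true]
  rw [sum_lowerWords_cons, ← sum_letterWeight, Finset.sum_mul_sum]
  simp only [embeddingWeight_cons]

theorem weightedSum_cons_cons (c : Option P) (a b : P) (u l : List P) :
    weightedSum c (a :: u) (b :: l) =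
      (if a = b then weightedSum (some b) u l else 0) +
        ((if c = some b then 1 else 0) - (if a = b then 1 else 0)) *
          weightedSum (some b) (a :: u) l := by
  classical
  rw [← sum_letterWeight_mul_ite, weightedSum, sum_lowerWords_cons]
  refine Finset.sum_congr rfl fun x _ => ?_
  have hiff (η : Fin l.length → WithBot P) :
      List.SublistForall₂ (· ≤ ·) (a :: u)
          (eraseBot (List.ofFn (Fin.cons x η : Fin (l.length + 1) → WithBot P))) ↔
        ((a : WithBot P) ≤ x ∧ List.SublistForall₂ (· ≤ ·) u (eraseBot (List.ofFn η))) ∨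
          (¬ (a : WithBot P) ≤ x ∧
            List.SublistForall₂ (· ≤ ·) (a :: u) (eraseBot (List.ofFn η))) := by
    rw [List.ofFn_cons, cons_sublistForall₂_eraseBot_cons_iff]
  simp only [embeddingWeight_cons]
  by_cases hax : (a : WithBot P) ≤ x
  · rw [if_pos hax, weightedSum, Finset.mul_sum]
    refine Finset.sum_congr rfl fun η _ => ?_
    rw [mul_ite, mul_zero]
    exact if_congr ((hiff η).trans (by simp [hax])) rfl rfl
  · rw [if_neg hax, weightedSum, Finset.mul_sum]
    refine Finset.sum_congr rfl fun η _ => ?_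
    rw [mul_ite, mul_zero]
    exact if_congr ((hiff η).trans (by simp [hax])) rfl rfl

open Classical in
/-- After a letter `p`, the weighted sum is the indicator of `l = p ⋯ p u`. -/
theorem weightedSum_some (p : P) (u l : List P) :
    weightedSum (some p) u l = if ∃ k, l = List.replicate k p ++ u then 1 else 0 := by
  induction l generalizing p u with
  | nil =>
    cases u with
    | nil =>
      rw [weightedSum_nil_nil, if_pos ⟨0, rfl⟩]
    | cons a u =>
      rw [weightedSum_cons_nil, if_neg]
      rintro ⟨k, hk⟩
      simp at hk
  | cons b l ih =>
    have hne (h : p ≠ b) (u : List P) :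
        (∃ k, b :: l = List.replicate k p ++ u) ↔ b :: l = u := by
      constructor
      · rintro ⟨_ | k, hk⟩
        · exact hk
        · rw [List.replicate_succ, List.cons_append, List.cons.injEq] at hk
          exact absurd hk.1.symm h
      · rintro rfl
        exact ⟨0, rfl⟩
    have heq (u : List P) (hu : b :: l ≠ u) :
        (∃ k, b :: l = List.replicate k b ++ u) ↔ ∃ k, l = List.replicate k b ++ u := by
      constructor
      · rintro ⟨_ | k, hk⟩
        · exact absurd hk hu
        · exact ⟨k, (List.cons.inj hk).2⟩
      · rintro ⟨k, rfl⟩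
        exact ⟨k + 1, rfl⟩
    cases u with
    | nil =>
      rw [weightedSum_nil_cons, ih]
      by_cases hp : p = b
      · subst hp
        rw [if_pos rfl, one_mul, if_congr (heq [] (List.cons_ne_nil _ _)) rfl rfl]
      · rw [if_congr (hne hp _) rfl rfl]
        simp [hp]
    | cons a u =>
      rw [weightedSum_cons_cons, ih, ih]
      by_cases hp : p = b <;> by_cases ha : a = b
      · subst hp ha
        -- the coefficient of `weightedSum (some a) (a :: u) l` is `1 - 1`
        have : (∃ k, a :: l = List.replicate k a ++ a :: u) ↔ ∃ k, l = List.replicate k a ++ u := by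
          refine exists_congr fun k => ?_
          rw [← List.singleton_append (l := u), ← List.append_assoc, ← List.replicate_succ',
            List.replicate_succ, List.cons_append, List.cons.injEq]
          exact and_iff_right rfl
        simp [this]
      · subst hp
        have hu : p :: l ≠ a :: u := fun h => ha (List.cons.inj h).1.symm
        simp [ha, heq _ hu]
      · subst ha
        -- the words `a ⋯ a u` other than `u` are the words `a ⋯ a (a :: u)`, and these cancel
        rw [if_congr (hne hp _) rfl rfl, if_congr exists_replicate_append_iff rfl rfl]
        by_cases hl : l = u
        · subst hl
          simp [hp, ne_replicate_append_cons]
        · simp only [hp, hl, if_true, if_false, false_or, Option.some.injEq, List.cons.injEq,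
            and_false]
          ring
      · rw [if_congr (hne hp _) rfl rfl]
        simp [hp, ha, Ne.symm ha]

/-- Without a preceding letter, the weighted sum is the indicator of `l = u`. -/
theorem weightedSum_none (u l : List P) :
    weightedSum none u l = if u = l then 1 else 0 := by
  classical
  cases l with
  | nil =>
    cases u with
    | nil => simp [weightedSum_nil_nil]
    | cons a u => simp [weightedSum_cons_nil]
  | cons b l =>
    cases u with
    | nil => simp [weightedSum_nil_cons]
    | cons a u =>
      rw [weightedSum_cons_cons, weightedSum_some, weightedSum_some]
      by_cases ha : a = b
      · subst ha
        -- the same cancellation as for a preceding letter different from `a`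
        rw [if_congr exists_replicate_append_iff rfl rfl]
        by_cases hl : l = u
        · subst hl
          simp [ne_replicate_append_cons]
        · simp only [hl, Ne.symm hl, if_true, if_false, false_or, List.cons.injEq, and_false,
            reduceCtorEq]
          ring
      · simp [ha]

/-! ### The sum over embeddings as an element of the incidence algebra -/

/-- The embeddings of `u` are the fibre over `u` of the deletion of zeros, so that summing over all
`v` and all embeddings of `v` is summing over `lowerWords`. -/
theorem mem_embeddings {u w : PosetWord P} {η : Fin w.length → WithBot P} :
    η ∈ embeddings u w ↔
      η ∈ lowerWords w.letters ∧ (⟨eraseBot (List.ofFn η)⟩ : PosetWord P) = u := by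
  rw [embeddings, Set.Finite.mem_toFinset, Set.mem_ofPred_eq, IsEmbedding, isExpansion_iff, and_comm]
  exact and_congr_left fun _ => mem_lowerWords.symm

theorem le_of_mem_embeddings {u w : PosetWord P} {η : Fin w.length → WithBot P}
    (h : η ∈ embeddings u w) : u ≤ w := by
  obtain ⟨hη, rfl⟩ := mem_embeddings.1 h
  exact le_iff_sublistForall₂.2 (sublistForall₂_eraseBot_ofFn (mem_lowerWords.1 hη))

variable (P) in
/-- The total weight of all embeddings of `u` in `w`, as an element of the incidence algebra of
the poset of words. -/
noncomputable def embeddingSum : IncidenceAlgebra ℤ (PosetWord P) where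
  toFun u w := ∑ η ∈ embeddings u w, embeddingWeight none w.letters η
  eq_zero_of_not_le' _ _ h :=
    Finset.sum_eq_zero fun _ hη => absurd (le_of_mem_embeddings hη) h

theorem embeddingSum_apply (u w : PosetWord P) :
    embeddingSum P u w = ∑ η ∈ embeddings u w, embeddingWeight none w.letters η := rfl

theorem sum_Icc_embeddingSum (u w : PosetWord P) :
    ∑ v ∈ Finset.Icc u w, embeddingSum P v w = if u = w then 1 else 0 := by
  classical
  rw [if_congr PosetWord.ext_iff rfl rfl, ← weightedSum_none, weightedSum, ← Finset.sum_filter]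
  have hmaps : ∀ η ∈ (lowerWords w.letters).filter
      (fun η => List.SublistForall₂ (· ≤ ·) u.letters (eraseBot (List.ofFn η))),
      (⟨eraseBot (List.ofFn η)⟩ : PosetWord P) ∈ Finset.Icc u w := by
    intro η hη
    rw [Finset.mem_filter, mem_lowerWords] at hη
    exact Finset.mem_Icc.2 ⟨le_iff_sublistForall₂.2 hη.2,
      le_iff_sublistForall₂.2 (sublistForall₂_eraseBot_ofFn hη.1)⟩
  rw [← Finset.sum_fiberwise_of_maps_to hmaps]
  refine Finset.sum_congr rfl fun v hv => ?_
  rw [embeddingSum_apply]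
  refine Finset.sum_congr ?_ fun _ _ => rfl
  ext η
  refine mem_embeddings.trans (Iff.trans ?_ Finset.mem_filter.symm)
  refine and_congr_left fun h => (and_iff_left ?_).symm.trans Finset.mem_filter.symm
  have := (Finset.mem_Icc.1 hv).1
  rw [← h] at this
  exact le_iff_sublistForall₂.1 this

theorem mu_eq_embeddingSum : mu ℤ = embeddingSum P := by
  classical
  refine left_inv_eq_right_inv (mu_mul_zeta ℤ (PosetWord P)) ?_
  ext u w
  rw [one_apply, ← sum_Icc_embeddingSum, mul_apply]
  exact Finset.sum_congr rfl fun v hv => by rw [zeta_of_le (Finset.mem_Icc.1 hv).1, one_mul]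

end PosetWord

open Classical in
theorem mainTheorem1 {P : Type*} [PartialOrder P] [DecidableEq P]
    [LocallyFiniteOrder (WithBot P)] (u w : PosetWord P) (huw : u ≤ w) :
    IncidenceAlgebra.mu ℤ u w =
      ∑ η ∈ PosetWord.embeddings u w, ∏ j : Fin w.length,
        if η j = ⊥ ∧ w.RepeatsPrevious j then
          IncidenceAlgebra.mu ℤ (η j) (w.letter j : WithBot P) + 1
        else
          IncidenceAlgebra.mu ℤ (η j) (w.letter j : WithBot P) := by
  rw [PosetWord.mu_eq_embeddingSum, PosetWord.embeddingSum_apply]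
  refine Finset.sum_congr rfl fun η _ => Finset.prod_congr rfl fun j _ => ?_
  exact if_congr (and_congr_right fun _ => PosetWord.repeatsPrevious_iff.symm) rfl rfl
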